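/- **Definitions.** Let $w$ be a word over the alphabet $\Sigma=\{1,\dots,n\}$. Two distinct symbols $x,y$ *alternate* in $w$ if the subsequence $\pi_{\{x,y\}}(w)$ of all occurrences of $x$ and $y$ in $w$ is one of $(xy)^k,\ (xy)^kx,\ (yx)^k,\ (yx)^ky$ with $k\ge 0$. The graph $G(w)$ has vertices $v_1,\dots,v_n$ and an edge $(v_x,v_y)$ iff $x \ne y$ alternate in $w$. Split $w$, reading from left to right, into *timestep factors*: a new factor starts exactly at each position whose symbol already occurs in the current factor. The temporal graph $TG(w)=(V,E_1,\dots,E_T)$ has one timestep per factor, and $E_t$ consists of the edges $(v_x,v_y)$ of $G(w)$ such that $x$ or $y$ occurs in the $t$-th factor. Its underlying graph is $(V,\bigcup_t E_t)$. A *temporal walk* is a sequence $(e_1,t_1),\dots,(e_k,t_k)$ with $e_i\in E_{t_i}$, the end point of $e_i$ equal to the start point of $e_{i+1}$, and $t_1<\dots<t_k$; it starts at the start point of $e_1$ and requires $t_k$ timesteps. It is an *exploration* if every vertex lies on one of its edges. **Theorem.** There is an absolute constant $c>0$ such that for all integers $n,d$ with $1\le d<n$ there is a word $v$ over $\{1,\dots,n\}$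 in which every symbol occurs, so that $TG(v)$ has $n$ vertices, with the following properties: 1. the underlying graph of $TG(v)$ is connected and has diameter exactly $d$; 2. $TG(v)$ has an exploration from every start vertex; 3. every exploration of $TG(v)$, from any start vertex, requires at least $c\,d\,n$ timesteps; 4. if $d\ge 2$, the vertex set is partitioned into $d+1$ layers $L_0,\dots,L_d$, each of size $\lfloor n/(d+1)\rfloor$ or $\lfloor n/(d+1)\rfloor+1$, such that two vertices are adjacent in the underlying graph iff they lie in consecutive layers. -/

import Mathlib

namespace WordTemporal

/-- The word `w ^ k`: the concatenation of `k` copies of `w`. -/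
def wordPow {α : Type*} (w : List α) (k : ℕ) : List α :=
  (List.replicate k w).flatten

/-- The projection `π_S(w)`: the longest subsequence of `w` that uses only symbols of `S`. -/
def proj {α : Type*} [DecidableEq α] (S : Finset α) (w : List α) : List α :=
  w.filter (fun a => a ∈ S)

/-- The symbols `x` and `y` alternate in `w`:
`π_{x,y}(w)` is one of `(xy)^k`, `(xy)^k x`, `(yx)^k`, `(yx)^k y` for some `k ≥ 0`. -/
def Alternate {α : Type*} [DecidableEq α] (w : List α) (x y : α) : Prop :=
  ∃ k : ℕ,
    proj {x, y} w = wordPow [x, y] k ∨ proj {x, y} w = wordPow [x, y] k ++ [x] ∨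
    proj {x, y} w = wordPow [y, x] k ∨ proj {x, y} w = wordPow [y, x] k ++ [y]

theorem Alternate.symm {α : Type*} [DecidableEq α] {w : List α} {x y : α}
    (h : Alternate w x y) : Alternate w y x := by
  obtain ⟨k, h⟩ := h
  refine ⟨k, ?_⟩
  rw [Finset.pair_comm y x]
  tauto

/-- The graph `G(w)` represented by the word `w`; its vertices are the symbols of the alphabet. -/
def wordGraph {α : Type*} [DecidableEq α] (w : List α) : SimpleGraph α where
  Adj x y := x ≠ y ∧ Alternate w x y
  symm := ⟨fun _ _ h => ⟨h.1.symm, h.2.symm⟩⟩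
  loopless := ⟨fun _ h => h.1 rfl⟩

/-- A temporal graph on the vertex set `V`. The timesteps are numbered `1, …, lifetime`;
timestep `i + 1` is `step i`. -/
structure TemporalGraph (V : Type*) where
  lifetime : ℕ
  step : Fin lifetime → SimpleGraph V

namespace TemporalGraph

/-- The edge `(x, y)` is active in timestep `t`, where `1 ≤ t ≤ lifetime`. -/
def Active {V : Type*} (𝒢 : TemporalGraph V) (t : ℕ) (x y : V) : Prop :=
  ∃ i : Fin 𝒢.lifetime, t = (i : ℕ) + 1 ∧ (𝒢.step i).Adj x y

/-- The underlying graph: the union of all timesteps. -/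
def underlying {V : Type*} (𝒢 : TemporalGraph V) : SimpleGraph V :=
  ⨆ i : Fin 𝒢.lifetime, 𝒢.step i

end TemporalGraph

/-- Auxiliary to `timestepFactors`: `cur` is the part of the current factor that has been read. -/
def timestepFactorsAux {α : Type*} [DecidableEq α] : List α → List α → List (List α)
  | cur, [] => [cur]
  | cur, a :: w =>
    if a ∈ cur then cur :: timestepFactorsAux [a] w
    else timestepFactorsAux (cur ++ [a]) w

/-- The timestep factors of `w`. Reading `w` from left to right, a new factor starts
exactly at those positions whose symbol already occurs in the current factor. -/
def timestepFactors {α : Type*} [DecidableEq α] : List α → List (List α)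
  | [] => []
  | a :: w => timestepFactorsAux [a] w

/-- The temporal graph `TG(w)` represented by the word `w`: there is one timestep for each
timestep factor, and an edge of `G(w)` is active in it iff at least one of its two end points
occurs in the factor. -/
def TG {α : Type*} [DecidableEq α] (w : List α) : TemporalGraph α where
  lifetime := (timestepFactors w).length
  step i :=
    { Adj := fun x y => (wordGraph w).Adj x y ∧
        (x ∈ (timestepFactors w).get i ∨ y ∈ (timestepFactors w).get i)
      symm := ⟨fun _ _ h => ⟨h.1.symm, h.2.symm⟩⟩
      loopless := ⟨fun _ h => h.1.ne rfl⟩ }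

/-- One step of a temporal walk: an edge with its start point and end point, and the timestep
in which it is traversed. -/
structure WalkStep (V : Type*) where
  src : V
  dst : V
  time : ℕ

/-- A temporal walk: every edge is active in the timestep in which it is traversed, consecutive
edges are connected, and the timesteps strictly increase. -/
def IsTemporalWalk {V : Type*} (𝒢 : TemporalGraph V) (P : List (WalkStep V)) : Prop :=
  (∀ s ∈ P, 𝒢.Active s.time s.src s.dst) ∧
  P.IsChain (fun s s' => s.dst = s'.src ∧ s.time < s'.time)

/-- The number of timesteps that a temporal walk requires: the timestep of its last edge. -/
def walkTime {V : Type*} (P : List (WalkStep V)) : ℕ :=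
  (P.getLast?.map WalkStep.time).getD 0

/-- `P` is an exploration of `𝒢` from `u`: a temporal walk whose first edge has start point `u`
and which visits every vertex. -/
def IsExploration {V : Type*} (𝒢 : TemporalGraph V) (u : V) (P : List (WalkStep V)) : Prop :=
  IsTemporalWalk 𝒢 P ∧ P.head?.map WalkStep.src = some u ∧
  ∀ x : V, ∃ s ∈ P, x = s.src ∨ x = s.dst

end WordTemporal

/-! For `d ≥ 2`, put `m = d / 2` and assign to each symbol a letter in `0, …, 2m+1`, one letter per
layer. A round consists of blocks `0, …, m`; block `k` writes letter `2k+1`, its neighbours `2k` and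
`2k+2`, then letter `2k+1` reversed. Each letter thus occurs twice per round, once forwards and once
reversed. Symbols of consecutive letters alternate, while any other pair meets a palindrome `L ++
L.reverse` in its projection and so has a doubled symbol. Hence the layers determine the underlying
graph (`wordGraph_wordPow_round_adj`), which has diameter `d` (`ediam_layered`).

The return of the repeated letter forces a cut in every block, so up to a final remainder there is
one timestep per block (`timestepFactors_wordPow_round`). The even blocks come in decreasing and
then the odd ones in increasing order, so the active zone sweeps down and up the layers by four
letters per timestep. A walk moves by one letter per edge and is left behind: every fourth edge
falls into a later sweep (`ramp_lt_ramp`, `le_ramp`). There are two sweeps per `m+1` timesteps and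
at least `n-1` edges are needed, so an exploration takes time of order `d n`. Explorations exist
because each edge is active in every round: a covering walk is followed at one edge per round.

For `d = 1`, powers of `1 2 … n` give the complete graph, and counting edges suffices. -/

namespace WordTemporal

/-! ### Alternation, timestep factors and concatenations of words -/

section Lists

variable {α : Type*} [DecidableEq α]

/-- A word alternating in `x` and `y` has no two equal consecutive symbols in its projection. -/
theorem Alternate.isChain {w : List α} {x y : α} (hxy : x ≠ y) (h : Alternate w x y) :
    (proj {x, y} w).IsChain (· ≠ ·) := by
  have key : ∀ (a b : α), a ≠ b → ∀ k : ℕ, (wordPow [a, b] k).IsChain (· ≠ ·) ∧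
      (wordPow [a, b] k ++ [a]).IsChain (· ≠ ·) := by
    intro a b hab k
    induction k with
    | zero => simp [wordPow]
    | succ k ih =>
      have e : wordPow [a, b] (k + 1) = a :: b :: wordPow [a, b] k := by
        simp [wordPow, List.replicate_succ]
      rw [e]
      cases k with
      | zero => simp [wordPow, hab, hab.symm]
      | succ k =>
        have e : wordPow [a, b] (k + 1) = a :: b :: wordPow [a, b] k := by
          simp [wordPow, List.replicate_succ]
        rw [e] at ih ⊢
        simp only [List.cons_append, List.isChain_cons_cons] at ih ⊢
        exact ⟨⟨hab, hab.symm, ih.1⟩, ⟨hab, hab.symm, ih.2⟩⟩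
  obtain ⟨k, h | h | h | h⟩ := h <;> rw [h]
  · exact (key x y hxy k).1
  · exact (key x y hxy k).2
  · exact (key y x hxy.symm k).1
  · exact (key y x hxy.symm k).2

/-- The last symbol of `L` is doubled in the middle of `L ++ L.reverse`. -/
theorem not_alternate_of_append_reverse {w L : List α} {x y : α} (hxy : x ≠ y) (hL : L ≠ [])
    (h : L ++ L.reverse <:+: proj {x, y} w) : ¬ Alternate w x y := by
  intro ha
  obtain ⟨M, z, rfl⟩ := List.eq_nil_or_concat L |>.resolve_left hL
  obtain ⟨p, s, e⟩ := h
  have h1 := ha.isChain hxy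
  rw [← e, show p ++ (M.concat z ++ (M.concat z).reverse) ++ s =
    (p ++ M) ++ ([z, z] ++ (M.reverse ++ s)) by simp] at h1
  have h2 := h1.right_of_append.left_of_append
  simp at h2

theorem proj_append (S : Finset α) (u w : List α) : proj S (u ++ w) = proj S u ++ proj S w :=
  List.filter_append ..

theorem proj_reverse (S : Finset α) (w : List α) : proj S w.reverse = (proj S w).reverse :=
  List.filter_reverse ..

theorem proj_flatMap {β : Type*} (S : Finset α) (l : List β) (g : β → List α) :
    proj S (l.flatMap g) = l.flatMap (fun b => proj S (g b)) :=
  List.filter_flatMap ..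

theorem wordPow_succ {β : Type*} (w : List β) (k : ℕ) : wordPow w (k + 1) = w ++ wordPow w k := by
  simp [wordPow, List.replicate_succ]

theorem proj_wordPow (S : Finset α) (w : List α) (k : ℕ) :
    proj S (wordPow w k) = wordPow (proj S w) k := by
  induction k with
  | zero => simp [wordPow, proj]
  | succ k ih => rw [wordPow_succ, wordPow_succ, proj_append, ih]

theorem wordPow_pair {β : Type*} (x y : β) (k : ℕ) : wordPow [x, y, x, y] k = wordPow [x, y] (2 * k) := by
  induction k with
  | zero => simp [wordPow]
  | succ k ih => rw [wordPow_succ, ih, show 2 * (k + 1) = 2 * k + 1 + 1 by ring]; simp [wordPow_succ]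

theorem alternate_wordPow {w : List α} {x y : α} (h : proj {x, y} w = [x, y, x, y]) (k : ℕ) :
    Alternate (wordPow w k) x y :=
  ⟨2 * k, Or.inl (by rw [proj_wordPow, h, wordPow_pair])⟩

/-- Factors that are free of repetitions and start with a symbol of the preceding factor are the
timestep factors of their concatenation. -/
theorem timestepFactors_flatten {F : List (List α)} (hnil : ∀ A ∈ F, A ≠ [])
    (hnodup : ∀ A ∈ F, A.Nodup) (hF : F.IsChain (fun A B => ∃ a ∈ A, B.head? = some a)) :
    timestepFactors F.flatten = F := by
  have key : ∀ (B cur rest : List α), (cur ++ B).Nodup →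
      timestepFactorsAux cur (B ++ rest) = timestepFactorsAux (cur ++ B) rest := by
    intro B
    induction B with
    | nil => simp
    | cons b B ih =>
      intro cur rest h
      have hb : b ∉ cur := fun hb => by
        rw [List.nodup_append] at h
        exact h.2.2 b hb b (by simp) rfl
      rw [List.cons_append, timestepFactorsAux, if_neg hb, ih _ _ (by simpa using h)]
      simp
  have aux : ∀ (F : List (List α)) (A : List α), (∀ B ∈ F, B.Nodup) →
      (A :: F).IsChain (fun A B => ∃ a ∈ A, B.head? = some a) →
      timestepFactorsAux A F.flatten = A :: F := by
    intro F
    induction F with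
    | nil => intro A _ _; simp [timestepFactorsAux]
    | cons B F ih =>
      intro A hn hc
      rw [List.isChain_cons_cons] at hc
      obtain ⟨⟨a, ha, hB⟩, hc⟩ := hc
      obtain ⟨B', rfl⟩ : ∃ B', B = a :: B' := by
        cases B with
        | nil => simp at hB
        | cons b B' => simp at hB; exact ⟨B', by rw [hB]⟩
      rw [List.flatten_cons, List.cons_append, timestepFactorsAux, if_pos ha,
        key _ _ _ (hn _ (by simp))]
      rw [List.singleton_append, ih _ (fun C hC => hn C (by simp [hC])) hc]
  cases F with
  | nil => rfl
  | cons A F =>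
    obtain ⟨a, A', rfl⟩ := List.exists_cons_of_ne_nil (hnil A (by simp))
    rw [List.flatten_cons, List.cons_append, timestepFactors, key _ _ _ (hnodup _ (by simp))]
    exact aux _ _ (fun B hB => hnodup B (by simp [hB])) hF

/-- With `p` the openings and `q` the carried closings, this regroups timestep factors into blocks.
-/
theorem flatMap_range_shift {β : Type*} (p q : ℕ → List β) (hq : q 0 = []) (N : ℕ) :
    (List.range N).flatMap (fun i => q i ++ p i) ++ q N =
      (List.range N).flatMap (fun i => p i ++ q (i + 1)) := by
  induction N with
  | zero => simp [hq]
  | succ N ih =>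
    rw [List.range_succ, List.flatMap_append, List.flatMap_append, ← ih]
    simp

theorem flatMap_range_mod {β : Type*} (h : ℕ → List β) (M K : ℕ) :
    (List.range (K * M)).flatMap (fun i => h (i % M)) = wordPow ((List.range M).flatMap h) K := by
  induction K with
  | zero => simp [wordPow]
  | succ K ih =>
    rw [show (K + 1) * M = M + K * M by ring, List.range_add, List.flatMap_append]
    rw [wordPow, List.replicate_succ, List.flatten_cons]
    rw [wordPow] at ih
    rw [← ih, List.flatMap_map]
    congr 1
    · exact List.flatMap_congr fun i hi => by rw [Nat.mod_eq_of_lt (List.mem_range.1 hi)]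
    · simp

theorem flatMap_eq_nil {β γ : Type*} {l : List γ} {h : γ → List β} (hl : ∀ s ∈ l, h s = []) :
    l.flatMap h = [] :=
  List.flatMap_eq_nil_iff.2 hl

theorem range_split {s t M : ℕ} (hst : s < t) (ht : t < M) :
    List.range M = List.range s ++ ([s] ++ (List.range' (s + 1) (t - s - 1) ++ ([t] ++
      List.range' (t + 1) (M - t - 1)))) := by
  have e1 : [s] = List.range' s 1 := rfl
  have e2 : [t] = List.range' t 1 := rfl
  rw [e1, e2, List.range_eq_range', List.range_eq_range']
  rw [show t = s + 1 + (t - s - 1) by omega]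
  generalize hu : t - s - 1 = u
  simp only [show s + 1 + u - s - 1 = u by omega]
  rw [List.range'_append_1, List.range'_append_1, List.range'_append_1]
  rw [show List.range' 0 s ++ List.range' s (1 + (u + (1 + (M - (s + 1 + u) - 1))))
    = List.range' 0 (s + (1 + (u + (1 + (M - (s + 1 + u) - 1))))) by
      simpa using List.range'_append_1 (s := 0) (m := s) (n := 1 + (u + (1 + (M - (s + 1 + u) - 1))))]
  congr 1
  omega

theorem infix_flatMap_range {β : Type*} {h : ℕ → List β} {s t M : ℕ} (hst : s < t) (ht : t < M)
    (hs : ∀ i, s < i → i < t → h i = []) : h s ++ h t <:+: (List.range M).flatMap h := by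
  rw [range_split hst ht]
  simp only [List.flatMap_append, List.flatMap_singleton]
  rw [flatMap_eq_nil (l := List.range' (s + 1) (t - s - 1))]
  · exact ⟨(List.range s).flatMap h, (List.range' (t + 1) (M - t - 1)).flatMap h, by simp⟩
  · intro i hi
    rw [List.mem_range'_1] at hi
    exact hs i (by omega) (by omega)

theorem flatMap_range_eq_pair {β : Type*} {h : ℕ → List β} {s t M : ℕ} (hst : s < t) (ht : t < M)
    (hs : ∀ i < M, i ≠ s → i ≠ t → h i = []) : (List.range M).flatMap h = h s ++ h t := by
  rw [range_split hst ht]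
  simp only [List.flatMap_append, List.flatMap_singleton]
  rw [flatMap_eq_nil (l := List.range s), flatMap_eq_nil (l := List.range' (s + 1) (t - s - 1)),
    flatMap_eq_nil (l := List.range' (t + 1) (M - t - 1))]
  · simp
  all_goals
    intro i hi
    first | rw [List.mem_range'_1] at hi | rw [List.mem_range] at hi
    exact hs i (by omega) (by omega) (by omega)

end Lists

/-! ### The word of a round and the graph it represents -/

section Word

variable {n : ℕ}

/-- The symbols of letter `l`, in increasing order. -/
def fiber (f : Fin n → ℕ) (l : ℕ) : List (Fin n) :=
  (List.finRange n).filter (fun x => f x = l)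

/-- The block `k` up to the first occurrence of its repeated letter `2 * k + 1` and of the
neighbouring letters. -/
def opening (f : Fin n → ℕ) (k : ℕ) : List (Fin n) :=
  fiber f (2 * k + 1) ++ if Even k then fiber f (2 * k + 2) ++ fiber f (2 * k)
    else (fiber f (2 * k)).reverse ++ (fiber f (2 * k + 2)).reverse

/-- The rest of the block `k`. -/
def closing (f : Fin n → ℕ) (k : ℕ) : List (Fin n) :=
  (fiber f (2 * k + 1)).reverse ++ if k = 0 then (fiber f 0).reverse else []

def block (f : Fin n → ℕ) (k : ℕ) : List (Fin n) :=
  opening f k ++ closing f k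

/-- The order of the blocks `0, …, m` in a round: the even ones in decreasing order, then the odd
ones in increasing order. -/
def blockAt (m s : ℕ) : ℕ :=
  if s ≤ m / 2 then 2 * (m / 2 - s) else 2 * (s - m / 2 - 1) + 1

/-- The position of the block `k` in a round. -/
def blockPos (m k : ℕ) : ℕ :=
  if Even k then m / 2 - k / 2 else m / 2 + 1 + k / 2

/-- Every even block precedes every odd one. Hence an even letter, which lies in two adjacent
blocks, is read forwards before it is read reversed. -/
def round (f : Fin n → ℕ) (m : ℕ) : List (Fin n) :=
  (List.range (m + 1)).flatMap (fun s => block f (blockAt m s))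

theorem blockAt_blockPos {m k : ℕ} (hk : k ≤ m) : blockAt m (blockPos m k) = k := by
  unfold blockAt blockPos
  rcases Nat.even_or_odd' k with ⟨j, rfl | rfl⟩
  · simp only [even_two_mul, if_true]
    split_ifs <;> omega
  · have h : ¬ Even (2 * j + 1) := by simp
    simp only [h, if_false]
    split_ifs <;> omega

theorem blockPos_le {m k : ℕ} (hk : k ≤ m) : blockPos m k ≤ m := by
  unfold blockPos
  split_ifs with h
  · omega
  · rw [Nat.not_even_iff] at h
    omega

theorem blockAt_le {m s : ℕ} (hs : s ≤ m) : blockAt m s ≤ m := by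
  unfold blockAt; split_ifs <;> omega

theorem blockPos_blockAt {m s : ℕ} : blockPos m (blockAt m s) = s := by
  unfold blockAt blockPos
  split_ifs with h1 h2 h2
  · omega
  · simp at h2
  · rw [Nat.even_iff] at h2; omega
  · omega

theorem blockAt_ne {m s k : ℕ} (h : s ≠ blockPos m k) : blockAt m s ≠ k := by
  rintro rfl
  exact h blockPos_blockAt.symm

@[simp] theorem mem_fiber {f : Fin n → ℕ} {l : ℕ} {x : Fin n} : x ∈ fiber f l ↔ f x = l := by
  simp [fiber]

theorem nodup_fiber (f : Fin n → ℕ) (l : ℕ) : (fiber f l).Nodup :=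
  (List.nodup_finRange n).filter _

theorem mem_opening {f : Fin n → ℕ} {k : ℕ} {x : Fin n} :
    x ∈ opening f k ↔ f x = 2 * k + 1 ∨ f x = 2 * k ∨ f x = 2 * k + 2 := by
  unfold opening
  split_ifs <;> simp [or_comm]

theorem mem_closing {f : Fin n → ℕ} {k : ℕ} {x : Fin n} :
    x ∈ closing f k ↔ f x = 2 * k + 1 ∨ (k = 0 ∧ f x = 0) := by
  unfold closing
  split_ifs with h <;> simp [h]

theorem proj_fiber_eq_nil {f : Fin n → ℕ} {l : ℕ} {x y : Fin n} (hx : f x ≠ l) (hy : f y ≠ l) :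
    proj {x, y} (fiber f l) = [] := by
  simp only [proj, List.filter_eq_nil_iff, mem_fiber]
  intro a ha
  simp only [Finset.mem_insert, Finset.mem_singleton, decide_eq_true_eq]
  rintro (rfl | rfl)
  · exact hx ha
  · exact hy ha

theorem proj_fiber_left {f : Fin n → ℕ} {l : ℕ} {x y : Fin n} (hx : f x = l) (hy : f y ≠ l) :
    proj {x, y} (fiber f l) = [x] := by
  have : (proj {x, y} (fiber f l)).Perm [x] := by
    refine (List.perm_ext_iff_of_nodup ((nodup_fiber f l).filter _) (by simp)).2 fun a => ?_
    simp only [List.mem_filter, mem_fiber, Finset.mem_insert, Finset.mem_singleton,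
      decide_eq_true_eq, List.mem_singleton]
    constructor
    · rintro ⟨h, rfl | rfl⟩
      · rfl
      · exact absurd h hy
    · rintro rfl
      exact ⟨hx, Or.inl rfl⟩
  exact List.perm_singleton.1 this

theorem proj_fiber_right {f : Fin n → ℕ} {l : ℕ} {x y : Fin n} (hx : f x ≠ l) (hy : f y = l) :
    proj {x, y} (fiber f l) = [y] := by
  rw [Finset.pair_comm, proj_fiber_left hy hx]

theorem proj_block_even {f : Fin n → ℕ} {k : ℕ} (hk : Even k) (hk0 : k ≠ 0) (S : Finset (Fin n)) :
    proj S (block f k) = proj S (fiber f (2 * k + 1)) ++ proj S (fiber f (2 * k + 2)) ++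
      proj S (fiber f (2 * k)) ++ (proj S (fiber f (2 * k + 1))).reverse := by
  simp [block, opening, closing, hk, hk0, proj_append, proj_reverse]

theorem proj_block_odd {f : Fin n → ℕ} {k : ℕ} (hk : ¬ Even k) (S : Finset (Fin n)) :
    proj S (block f k) = proj S (fiber f (2 * k + 1)) ++ (proj S (fiber f (2 * k))).reverse ++
      (proj S (fiber f (2 * k + 2))).reverse ++ (proj S (fiber f (2 * k + 1))).reverse := by
  have hk0 : k ≠ 0 := by rintro rfl; simp at hk
  simp [block, opening, closing, hk, hk0, proj_append, proj_reverse]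

theorem proj_block_zero {f : Fin n → ℕ} (S : Finset (Fin n)) :
    proj S (block f 0) = proj S (fiber f 1) ++ proj S (fiber f 2) ++
      proj S (fiber f 0) ++ (proj S (fiber f 1)).reverse ++ (proj S (fiber f 0)).reverse := by
  simp [block, opening, closing, proj_append, proj_reverse]

theorem mem_block {f : Fin n → ℕ} {k : ℕ} {x : Fin n} :
    x ∈ block f k ↔ f x = 2 * k + 1 ∨ f x = 2 * k ∨ f x = 2 * k + 2 := by
  rw [block, List.mem_append, mem_opening, mem_closing]
  omega

theorem proj_block_eq_nil {f : Fin n → ℕ} {k : ℕ} {x y : Fin n}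
    (hx : f x < 2 * k ∨ 2 * k + 2 < f x) (hy : f y < 2 * k ∨ 2 * k + 2 < f y) :
    proj {x, y} (block f k) = [] := by
  simp only [proj, List.filter_eq_nil_iff, mem_block]
  intro a ha
  simp only [Finset.mem_insert, Finset.mem_singleton, decide_eq_true_eq]
  rintro (rfl | rfl) <;> omega

/-- The projection of a round to two letters which occur in at most two blocks. -/
theorem proj_round_pair {f : Fin n → ℕ} {m k k' : ℕ} {x y : Fin n} (hk : k ≤ m) (hk' : k' ≤ m)
    (hpos : blockPos m k < blockPos m k')
    (h : ∀ i, i ≠ k → i ≠ k' → proj {x, y} (block f i) = []) :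
    proj {x, y} (round f m) = proj {x, y} (block f k) ++ proj {x, y} (block f k') := by
  rw [round, proj_flatMap, flatMap_range_eq_pair hpos (Nat.lt_succ_of_le (blockPos_le hk')),
    blockAt_blockPos hk, blockAt_blockPos hk']
  intro i _ h1 h2
  exact h _ (blockAt_ne h1) (blockAt_ne h2)

theorem blockPos_lt {m k k' : ℕ} (hk : Even k) (hk' : ¬ Even k') : blockPos m k < blockPos m k' := by
  rw [blockPos, if_pos hk, blockPos, if_neg hk']
  omega

theorem proj_isInfix {S : Finset (Fin n)} {u w : List (Fin n)} (h : u <:+: w) :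
    proj S u <:+: proj S w := by
  obtain ⟨p, s, rfl⟩ := h
  exact ⟨proj S p, proj S s, by simp [proj_append]⟩

theorem block_infix_round (f : Fin n → ℕ) {m k : ℕ} (hk : k ≤ m) : block f k <:+: round f m := by
  obtain ⟨p, s, h⟩ := List.append_of_mem
    (List.mem_range.2 (Nat.lt_succ_of_le (blockPos_le hk)))
  refine ⟨p.flatMap (fun s => block f (blockAt m s)), s.flatMap (fun s => block f (blockAt m s)), ?_⟩
  rw [round, Nat.add_one, h]
  simp [blockAt_blockPos hk]

/-- Let `z` be the symbol with the odd letter `2k+1` and `w` the other one. Block `k` gives `z w z`,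
and the other block containing `w` gives `w`; in either order a round projects to an alternating
word of length four. Letter `0` lies in no other block, which is why the closing of block `0`
repeats it. -/
theorem alternate_succ {f : Fin n → ℕ} {m : ℕ} (hm : 1 ≤ m) (hf : ∀ x, f x ≤ 2 * m + 1) (K : ℕ)
    {x y : Fin n} (hxy : f x + 1 = f y) : Alternate (wordPow (round f m) K) x y := by
  have hy := hf y
  rcases Nat.even_or_odd' (f x) with ⟨a, ha | ha⟩
  · -- the letter of `y` is the repeated letter of the block `a`
    have pa : proj {x, y} (fiber f (2 * a)) = [x] := proj_fiber_left ha (by omega)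
    have pa1 : proj {x, y} (fiber f (2 * a + 1)) = [y] := proj_fiber_right (by omega) (by omega)
    have pn : ∀ l, l ≠ 2 * a → l ≠ 2 * a + 1 → proj {x, y} (fiber f l) = [] :=
      fun l h1 h2 => proj_fiber_eq_nil (by omega) (by omega)
    by_cases hev : Even a
    · rcases Nat.eq_zero_or_pos a with rfl | ha0
      · refine (alternate_wordPow ?_ K).symm
        rw [Finset.pair_comm, proj_round_pair (k := 0) (k' := 1) (by omega) hm
          (blockPos_lt hev (by simp)) fun i h0 h1 => proj_block_eq_nil (by omega) (by omega),
          proj_block_zero, proj_block_odd (by simp)]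
        simp only [mul_zero, zero_add] at pa pa1
        rw [pa, pa1, pn _ (by omega) (by omega), pn _ (by omega) (by omega),
          pn _ (by omega) (by omega)]
        rfl
      · obtain ⟨b, rfl⟩ : ∃ b, a = b + 1 := ⟨a - 1, by omega⟩
        have hb : ¬ Even b := by rwa [Nat.even_add_one] at hev
        refine (alternate_wordPow ?_ K).symm
        rw [Finset.pair_comm, proj_round_pair (k := b + 1) (k' := b) (by omega) (by omega)
          (blockPos_lt hev hb) fun i h0 h1 => proj_block_eq_nil (by omega) (by omega),
          proj_block_even hev (by omega), proj_block_odd hb]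
        rw [pa, pa1, pn (2 * (b + 1) + 2) (by omega) (by omega), pn (2 * b + 1) (by omega) (by omega),
          pn (2 * b) (by omega) (by omega), show 2 * b + 2 = 2 * (b + 1) by ring, pa]
        rfl
    · obtain ⟨b, rfl⟩ : ∃ b, a = b + 1 :=
        ⟨a - 1, by rcases Nat.eq_zero_or_pos a with rfl | h; · simp at hev
                   omega⟩
      have hb : Even b := by rwa [Nat.even_add_one, not_not] at hev
      refine alternate_wordPow ?_ K
      rw [proj_round_pair (k := b) (k' := b + 1) (by omega) (by omega)
        (blockPos_lt hb hev) fun i h0 h1 => proj_block_eq_nil (by omega) (by omega),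
        proj_block_odd hev]
      have e : proj {x, y} (block f b) = [x] := by
        rcases Nat.eq_zero_or_pos b with rfl | hb0
        · rw [proj_block_zero, pn 1 (by omega) (by omega), pn 0 (by omega) (by omega)]
          simpa using pa
        · rw [proj_block_even hb (by omega), pn (2 * b + 1) (by omega) (by omega),
            pn (2 * b) (by omega) (by omega), show 2 * b + 2 = 2 * (b + 1) by ring, pa]
          rfl
      rw [e, pa, pa1, pn _ (by omega) (by omega)]
      rfl
  · -- the letter of `x` is the repeated letter of the block `a`
    have pa : proj {x, y} (fiber f (2 * a + 1)) = [x] := proj_fiber_left ha (by omega)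
    have pa1 : proj {x, y} (fiber f (2 * a + 2)) = [y] := proj_fiber_right (by omega) (by omega)
    have pn : ∀ l, l ≠ 2 * a + 1 → l ≠ 2 * a + 2 → proj {x, y} (fiber f l) = [] :=
      fun l h1 h2 => proj_fiber_eq_nil (by omega) (by omega)
    by_cases hev : Even a
    · have hev' : ¬ Even (a + 1) := by simpa [Nat.even_add_one] using hev
      refine alternate_wordPow ?_ K
      rw [proj_round_pair (k := a) (k' := a + 1) (by omega) (by omega)
        (blockPos_lt hev hev') fun i h0 h1 => proj_block_eq_nil (by omega) (by omega),
        proj_block_odd hev']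
      have e : proj {x, y} (block f a) = [x, y, x] := by
        rcases Nat.eq_zero_or_pos a with rfl | hb0
        · simp only [mul_zero, zero_add] at pa pa1
          rw [proj_block_zero, pa, pa1, pn 0 (by omega) (by omega)]
          rfl
        · rw [proj_block_even hev (by omega), pa, pa1, pn (2 * a) (by omega) (by omega)]
          rfl
      rw [e, show 2 * (a + 1) = 2 * a + 2 by ring, pa1, pn _ (by omega) (by omega),
        pn _ (by omega) (by omega)]
      rfl
    · have hev' : Even (a + 1) := by simpa [Nat.even_add_one] using hev
      refine (alternate_wordPow ?_ K).symm
      rw [Finset.pair_comm, proj_round_pair (k := a + 1) (k' := a) (by omega) (by omega)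
        (blockPos_lt hev' hev) fun i h0 h1 => proj_block_eq_nil (by omega) (by omega),
        proj_block_even hev' (by omega), proj_block_odd hev, pa, pa1,
        show 2 * (a + 1) = 2 * a + 2 by ring, pa1, pn _ (by omega) (by omega),
        pn (2 * a + 2 + 2) (by omega) (by omega), pn (2 * a) (by omega) (by omega)]
      rfl

/-- Once the neighbouring letters are projected away, the two copies of letter `2k+1` in block `k`
become adjacent and form a palindrome. -/
theorem not_alternate_odd {f : Fin n → ℕ} {m k K : ℕ} (hK : 1 ≤ K) (hk : k ≤ m) {x y : Fin n}
    (hxy : x ≠ y) (hx : f x = 2 * k + 1) (hy : f y ≠ 2 * k) (hy' : f y ≠ 2 * k + 2) :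
    ¬ Alternate (wordPow (round f m) K) x y := by
  obtain ⟨K, rfl⟩ : ∃ j, K = j + 1 := ⟨K - 1, by omega⟩
  have hinf : block f k <:+: wordPow (round f m) (K + 1) := by
    rw [wordPow_succ]
    exact (block_infix_round f hk).trans (List.prefix_append _ _).isInfix
  refine not_alternate_of_append_reverse (L := proj {x, y} (fiber f (2 * k + 1))) hxy
    (List.ne_nil_of_mem (a := x) (by simp [proj, hx])) ?_
  refine .trans ?_ (proj_isInfix hinf)
  have p0 : proj {x, y} (fiber f (2 * k)) = [] := proj_fiber_eq_nil (by omega) hy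
  have p2 : proj {x, y} (fiber f (2 * k + 2)) = [] := proj_fiber_eq_nil (by omega) hy'
  by_cases hev : Even k
  · rcases Nat.eq_zero_or_pos k with rfl | h0
    · simp only [mul_zero, zero_add] at p0 p2
      rw [proj_block_zero, p0, p2]
      simp
    · rw [proj_block_even hev (by omega), p0, p2]
      simp
  · rw [proj_block_odd hev, p0, p2]
    simp

/-- For `a > 0`, the two copies of letter `2a` lie in blocks `a-1` and `a`, one even and one odd.
Within both blocks the order of the neighbours keeps letter `2a+2` outside the gap between these
copies, so a palindrome remains. For `a = 0` it lies inside block `0`. -/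
theorem not_alternate_even {f : Fin n → ℕ} {m a K : ℕ} (hK : 1 ≤ K) (ha : a ≤ m) {x y : Fin n}
    (hxy : x ≠ y) (hx : f x = 2 * a) (hy : Even (f y)) (hle : f x ≤ f y) :
    ¬ Alternate (wordPow (round f m) K) x y := by
  obtain ⟨K, rfl⟩ : ∃ j, K = j + 1 := ⟨K - 1, by omega⟩
  rw [even_iff_exists_two_mul] at hy
  obtain ⟨c, hc⟩ := hy
  refine not_alternate_of_append_reverse (L := proj {x, y} (fiber f (2 * a))) hxy
    (List.ne_nil_of_mem (a := x) (by simp [proj, hx])) ?_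
  refine .trans ?_ (proj_isInfix (u := round f m) ?_)
  swap
  · rw [wordPow_succ]
    exact (List.prefix_append _ _).isInfix
  have podd : ∀ k, proj {x, y} (fiber f (2 * k + 1)) = [] :=
    fun k => proj_fiber_eq_nil (by omega) (by omega)
  have plt : ∀ k < a, proj {x, y} (fiber f (2 * k)) = [] :=
    fun k hk => proj_fiber_eq_nil (by omega) (by omega)
  have hinf : ∀ k k', k ≤ a → k' ≤ a → Even k → ¬ Even k' →
      proj {x, y} (block f k) ++ proj {x, y} (block f k') <:+: proj {x, y} (round f m) := by
    intro k k' hk hk' hev hev'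
    have := infix_flatMap_range (h := fun s => proj {x, y} (block f (blockAt m s)))
      (blockPos_lt (m := m) hev hev') (Nat.lt_succ_of_le (blockPos_le (hk'.trans ha))) (by
        intro i h1 h2
        -- A block between these two positions is even and below `k`, or odd and below `k'`. Its
        -- index is at most `a - 2`, so all its letters are below `2a`.
        refine proj_block_eq_nil ?_ ?_ <;>
        · right
          rw [blockPos, if_pos hev] at h1
          rw [blockPos, if_neg hev'] at h2
          rw [Nat.not_even_iff] at hev'
          rw [Nat.even_iff] at hev
          unfold blockAt
          split_ifs <;> omega)
    rw [blockAt_blockPos (hk.trans ha), blockAt_blockPos (hk'.trans ha)] at this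
    rw [round, proj_flatMap]
    exact this
  rcases Nat.eq_zero_or_pos a with rfl | ha0
  · refine .trans ?_ (proj_isInfix (block_infix_round f ha))
    have := podd 0
    simp only [mul_zero, zero_add] at this
    rw [proj_block_zero, this]
    exact ⟨proj {x, y} (fiber f 2), [], by simp⟩
  obtain ⟨b, rfl⟩ : ∃ b, a = b + 1 := ⟨a - 1, by omega⟩
  by_cases hev : Even b
  · have hev' : ¬ Even (b + 1) := by simpa [Nat.even_add_one] using hev
    refine .trans ?_ (hinf b (b + 1) (by omega) le_rfl hev hev')
    have e : proj {x, y} (block f b) = proj {x, y} (fiber f (2 * (b + 1))) := by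
      rcases Nat.eq_zero_or_pos b with rfl | hb0
      · have p1 := podd 0
        have p0 := plt 0 (by omega)
        simp only [mul_zero, zero_add] at p0 p1
        rw [proj_block_zero, p0, p1]
        simp
      · rw [proj_block_even hev (by omega), podd, plt b (by omega),
          show 2 * b + 2 = 2 * (b + 1) by ring]
        simp
    rw [e, proj_block_odd hev', podd]
    exact ⟨[], (proj {x, y} (fiber f (2 * (b + 1) + 2))).reverse, by simp⟩
  · have hev' : Even (b + 1) := by simpa [Nat.even_add_one] using hev
    refine .trans ?_ (hinf (b + 1) b le_rfl (by omega) hev' hev)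
    rw [proj_block_odd hev, proj_block_even hev' (by omega), podd, podd, plt b (by omega),
      show 2 * b + 2 = 2 * (b + 1) by ring]
    exact ⟨proj {x, y} (fiber f (2 * (b + 1) + 2)), [], by simp⟩

theorem wordGraph_wordPow_round_adj {f : Fin n → ℕ} {m K : ℕ} (hm : 1 ≤ m) (hK : 1 ≤ K)
    (hf : ∀ x, f x ≤ 2 * m + 1) (x y : Fin n) :
    (wordGraph (wordPow (round f m) K)).Adj x y ↔ f x + 1 = f y ∨ f y + 1 = f x := by
  have hx := hf x
  have hy := hf y
  constructor
  · rintro ⟨hxy, h⟩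
    by_contra hne
    rcases Nat.even_or_odd' (f x) with ⟨a, ha | ha⟩
    · rcases Nat.even_or_odd' (f y) with ⟨b, hb | hb⟩
      · rcases le_total (f x) (f y) with hle | hle
        · exact not_alternate_even hK (by omega) hxy ha (hb ▸ even_two_mul b) hle h
        · exact not_alternate_even hK (by omega) hxy.symm hb (ha ▸ even_two_mul a) hle h.symm
      · exact not_alternate_odd hK (by omega) hxy.symm hb (by omega) (by omega) h.symm
    · exact not_alternate_odd hK (by omega) hxy ha (by omega) (by omega) h
  · rintro (h | h)
    · exact ⟨by rintro rfl; omega, alternate_succ hm hf K h⟩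
    · exact ⟨by rintro rfl; omega, (alternate_succ hm hf K h).symm⟩

end Word

/-! ### The timestep factors of the word -/

section Factors

variable {n : ℕ}

/-- The part of the timestep factor `i` which belongs to the preceding block. -/
def carry (f : Fin n → ℕ) (m i : ℕ) : List (Fin n) :=
  if i = 0 then [] else closing f (blockAt m ((i - 1) % (m + 1)))

def factor (f : Fin n → ℕ) (m i : ℕ) : List (Fin n) :=
  carry f m i ++ opening f (blockAt m (i % (m + 1)))

/-- The final remainder is the closing of the last block, with no opening after it. -/
def factorList (f : Fin n → ℕ) (m N : ℕ) : List (List (Fin n)) :=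
  (List.range N).map (factor f m) ++ [carry f m N]

theorem flatten_factorList (f : Fin n → ℕ) (m K : ℕ) :
    (factorList f m (K * (m + 1))).flatten = wordPow (round f m) K := by
  rw [round, ← flatMap_range_mod (fun s => block f (blockAt m s))]
  have := flatMap_range_shift (fun i => opening f (blockAt m (i % (m + 1)))) (carry f m)
    (by simp [carry]) (K * (m + 1))
  rw [factorList, List.flatten_append, ← List.flatMap_def, List.flatten_singleton]
  refine this.trans (List.flatMap_congr fun i _ => ?_)
  simp [carry, block]

theorem nodup_opening (f : Fin n → ℕ) (k : ℕ) : (opening f k).Nodup := by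
  unfold opening
  split_ifs
  all_goals
    simp only [List.nodup_append, List.nodup_reverse, nodup_fiber, true_and, List.mem_append,
      List.mem_reverse, mem_fiber]
    refine ⟨?_, ?_⟩
    all_goals
      rintro a ha b hb rfl
      omega

theorem nodup_closing (f : Fin n → ℕ) (k : ℕ) : (closing f k).Nodup := by
  unfold closing
  split_ifs
  · simp only [List.nodup_append, List.nodup_reverse, nodup_fiber, true_and, List.mem_reverse,
      mem_fiber]
    rintro a ha b hb rfl
    omega
  · simpa using nodup_fiber f _

theorem nodup_carry (f : Fin n → ℕ) (m i : ℕ) : (carry f m i).Nodup := by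
  unfold carry
  split_ifs
  · simp
  · exact nodup_closing f _

/-- Block indices move by two inside a sweep and by one where sweeps meet. Block `0`, whose closing
also contains letter `0`, is always followed by block `1`, where that letter does not occur. -/
theorem blockAt_mod_succ {m : ℕ} (hm : 1 ≤ m) (i : ℕ) :
    (blockAt m (i % (m + 1)) = 0 ∧ blockAt m ((i + 1) % (m + 1)) = 1) ∨
    (blockAt m (i % (m + 1)) ≠ 0 ∧
      blockAt m (i % (m + 1)) ≠ blockAt m ((i + 1) % (m + 1)) ∧
      blockAt m (i % (m + 1)) ≤ blockAt m ((i + 1) % (m + 1)) + 2 ∧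
      blockAt m ((i + 1) % (m + 1)) ≤ blockAt m (i % (m + 1)) + 2) := by
  have h1 : i % (m + 1) < m + 1 := Nat.mod_lt _ (by omega)
  have h2 : (i + 1) % (m + 1) = if i % (m + 1) = m then 0 else i % (m + 1) + 1 := by
    rw [Nat.add_mod, Nat.mod_eq_of_lt (show 1 < m + 1 by omega)]
    split_ifs with h
    · rw [h, Nat.mod_self]
    · exact Nat.mod_eq_of_lt (by omega)
  rw [h2]
  generalize i % (m + 1) = s at *
  unfold blockAt
  split_ifs <;> omega

theorem nodup_factor {m : ℕ} (hm : 1 ≤ m) (f : Fin n → ℕ) (i : ℕ) : (factor f m i).Nodup := by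
  rw [factor, List.nodup_append]
  refine ⟨nodup_carry f m i, nodup_opening f _, ?_⟩
  rintro a ha b hb rfl
  cases i with
  | zero => simp [carry] at ha
  | succ i =>
    have := blockAt_mod_succ hm i
    rw [carry, if_neg (by omega), mem_closing, Nat.add_sub_cancel] at ha
    rw [mem_opening] at hb
    omega

theorem exists_opening_closing {f : Fin n → ℕ} {k : ℕ} (h : ∃ x, f x = 2 * k + 1) :
    ∃ a ∈ opening f k, (closing f k).head? = some a := by
  obtain ⟨x, hx⟩ := h
  have hne : (fiber f (2 * k + 1)).reverse ≠ [] := List.ne_nil_of_mem (a := x) (by simp [hx])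
  obtain ⟨a, l, hl⟩ := List.exists_cons_of_ne_nil hne
  refine ⟨a, ?_, ?_⟩
  · have : a ∈ (fiber f (2 * k + 1)).reverse := by rw [hl]; simp
    simp only [List.mem_reverse, mem_fiber] at this
    rw [mem_opening]
    exact Or.inl this
  · rw [closing, hl]
    rfl

/-- A closing begins with a symbol of the repeated letter, already present in the opening, so a cut
falls there. No other cut occurs, since a closing shares no symbol with the next opening. -/
theorem timestepFactors_wordPow_round {f : Fin n → ℕ} {m K : ℕ} (hm : 1 ≤ m) (hK : 1 ≤ K)
    (hsurj : ∀ l, 1 ≤ l → l ≤ 2 * m + 1 → ∃ x, f x = l) :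
    timestepFactors (wordPow (round f m) K) = factorList f m (K * (m + 1)) := by
  have hN : K * (m + 1) ≠ 0 := by positivity
  have hlink : ∀ i, ∃ a ∈ factor f m i, (carry f m (i + 1)).head? = some a := by
    intro i
    have hle := blockAt_le (m := m) (s := i % (m + 1))
      (Nat.lt_succ_iff.1 (Nat.mod_lt i (Nat.succ_pos m)))
    obtain ⟨a, ha, h⟩ := exists_opening_closing (f := f) (k := blockAt m (i % (m + 1)))
      (hsurj _ (by omega) (by omega))
    exact ⟨a, by simp [factor, ha], by simpa [carry] using h⟩
  rw [← flatten_factorList]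
  refine timestepFactors_flatten ?_ ?_ ?_
  · intro A hA
    simp only [factorList, List.mem_append, List.mem_map, List.mem_singleton] at hA
    rcases hA with ⟨i, -, rfl⟩ | rfl
    · obtain ⟨a, ha, -⟩ := hlink i
      exact List.ne_nil_of_mem ha
    · obtain ⟨N, hN⟩ := Nat.exists_eq_succ_of_ne_zero hN
      obtain ⟨a, -, ha⟩ := hlink N
      rw [hN]
      rintro h
      rw [Nat.succ_eq_add_one] at h
      rw [h] at ha
      simp at ha
  · intro A hA
    simp only [factorList, List.mem_append, List.mem_map, List.mem_singleton] at hA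
    rcases hA with ⟨i, -, rfl⟩ | rfl
    · exact nodup_factor hm f i
    · exact nodup_carry f m _
  · rw [List.isChain_iff_getElem]
    intro i hi
    obtain ⟨a, ha, h⟩ := hlink i
    simp only [factorList, List.length_append, List.length_map, List.length_range,
      List.length_singleton] at hi
    simp only [factorList]
    rw [List.getElem_append_left (by simp; omega)]
    refine ⟨a, by simpa using ha, ?_⟩
    by_cases h1 : i + 1 < K * (m + 1)
    · rw [List.getElem_append_left (by simpa using h1)]
      simp only [List.getElem_map, List.getElem_range, factor, List.head?_append, h]
      rfl
    · have h2 : i + 1 = K * (m + 1) := by omega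
      rw [List.getElem_append_right (by simp; omega)]
      simpa [← h2] using h

end Factors

/-! ### Temporal walks: existence of explorations and elementary bounds -/

section Temporal

variable {α : Type*} [DecidableEq α]

theorem active_TG_iff {w : List α} {t : ℕ} {x y : α} :
    (TG w).Active t x y ↔ (wordGraph w).Adj x y ∧
      ∃ i A, t = i + 1 ∧ (timestepFactors w)[i]? = some A ∧ (x ∈ A ∨ y ∈ A) := by
  constructor
  · rintro ⟨i, rfl, h, h'⟩
    exact ⟨h, i, _, rfl, List.getElem?_eq_getElem i.2, h'⟩
  · rintro ⟨h, i, A, rfl, hA, h'⟩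
    obtain ⟨hi, rfl⟩ := List.getElem?_eq_some_iff.1 hA
    exact ⟨⟨i, hi⟩, rfl, h, h'⟩

theorem underlying_adj_iff {V : Type*} {𝒢 : TemporalGraph V} {x y : V} :
    𝒢.underlying.Adj x y ↔ ∃ t, 𝒢.Active t x y := by
  simp only [TemporalGraph.underlying, SimpleGraph.iSup_adj, TemporalGraph.Active]
  exact ⟨fun ⟨i, h⟩ => ⟨_, i, rfl, h⟩, fun ⟨_, i, _, h⟩ => ⟨i, h⟩⟩

/-- The bound `L` is uniform in the start vertex, so that one word serves all starts. -/
theorem exists_covering_walk {V : Type*} [Finite V] {G : SimpleGraph V} (hG : G.Preconnected) :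
    ∃ L : ℕ, ∀ u, ∃ (v : V) (p : G.Walk u v), p.length ≤ L ∧ ∀ x, x ∈ p.support := by
  classical
  have := Fintype.ofFinite V
  have key : ∀ (s : Finset V) (u : V), ∃ (v : V) (p : G.Walk u v), ∀ x ∈ s, x ∈ p.support := by
    intro s u
    induction s using Finset.induction_on with
    | empty => exact ⟨u, .nil, by simp⟩
    | insert a s _ ih =>
      obtain ⟨v, p, hp⟩ := ih
      obtain ⟨q⟩ := hG v a
      refine ⟨a, p.append q, fun x hx => ?_⟩
      rw [SimpleGraph.Walk.mem_support_append_iff]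
      rcases Finset.mem_insert.1 hx with rfl | hx
      · exact Or.inr q.end_mem_support
      · exact Or.inl (hp x hx)
  choose v p hp using key Finset.univ
  exact ⟨Finset.univ.sup fun u => (p u).length, fun u => ⟨v u, p u,
    Finset.le_sup (f := fun u => (p u).length) (Finset.mem_univ u),
    fun x => hp u x (Finset.mem_univ x)⟩⟩

/-- If every edge of `G` is active in each of `K` windows of `M` timesteps, a walk of length at
most `K` can be followed in time. -/
theorem exists_temporalWalk_of_walk {V : Type*} {𝒢 : TemporalGraph V} {G : SimpleGraph V} {M K : ℕ}
    (hact : ∀ r < K, ∀ x y, G.Adj x y → ∃ t, r * M < t ∧ t ≤ (r + 1) * M ∧ 𝒢.Active t x y)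
    {u v : V} (p : G.Walk u v) : ∀ r, r + p.length ≤ K →
    ∃ P : List (WalkStep V), IsTemporalWalk 𝒢 P ∧ (∀ s ∈ P.head?, s.src = u ∧ r * M < s.time) ∧
      (P = [] → p.length = 0) ∧ (p.length ≠ 0 → ∀ x ∈ p.support, ∃ s ∈ P, x = s.src ∨ x = s.dst) := by
  induction p with
  | nil =>
    intro r _
    exact ⟨[], ⟨by simp, by simp⟩, by simp, by simp, by simp⟩
  | @cons a b c h p ih =>
    intro r hr
    rw [SimpleGraph.Walk.length_cons] at hr
    obtain ⟨t, h1, h2, h3⟩ := hact r (by omega) a b h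
    obtain ⟨P, hP, hh, hn, hs⟩ := ih (r + 1) (by omega)
    refine ⟨⟨a, b, t⟩ :: P, ⟨?_, ?_⟩, ?_, by simp, ?_⟩
    · simp only [List.mem_cons, forall_eq_or_imp]
      exact ⟨h3, hP.1⟩
    · rw [List.isChain_cons]
      exact ⟨fun s hsP => ⟨(hh s hsP).1.symm, h2.trans_lt (hh s hsP).2⟩, hP.2⟩
    · simp [h1]
    · intro _ x hx
      rw [SimpleGraph.Walk.support_cons, List.mem_cons] at hx
      rcases hx with rfl | hx
      · exact ⟨_, List.mem_cons_self, Or.inl rfl⟩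
      · by_cases hp : p.length = 0
        · cases p with
          | nil => exact ⟨_, List.mem_cons_self, Or.inr (by simpa using hx)⟩
          | cons => simp at hp
        · obtain ⟨s, hs, hx⟩ := hs hp x hx
          exact ⟨s, List.mem_cons_of_mem _ hs, hx⟩

theorem exists_isExploration {V : Type*} [Nontrivial V] {𝒢 : TemporalGraph V} {G : SimpleGraph V}
    {M K : ℕ}
    (hact : ∀ r < K, ∀ x y, G.Adj x y → ∃ t, r * M < t ∧ t ≤ (r + 1) * M ∧ 𝒢.Active t x y)
    {u v : V} (p : G.Walk u v) (hp : p.length ≤ K) (hs : ∀ x, x ∈ p.support) :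
    ∃ P, IsExploration 𝒢 u P := by
  obtain ⟨P, hP, hh, hn, hv⟩ := exists_temporalWalk_of_walk hact p 0 (by omega)
  have hlen : p.length ≠ 0 := by
    intro h
    obtain ⟨x, hx⟩ := exists_ne u
    have := hs x
    cases p with
    | nil => simp at this; exact hx this
    | cons => simp at h
  refine ⟨P, hP, ?_, fun x => hv hlen x (hs x)⟩
  obtain ⟨s, P', rfl⟩ := List.exists_cons_of_ne_nil (fun h => hlen (hn h))
  simpa using (hh s (by simp)).1

/-- Time grows by at least one per edge, and a labelling that is 1-Lipschitz along active edges
changes by at most one. -/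
theorem IsTemporalWalk.getElem_add {V : Type*} {𝒢 : TemporalGraph V} {P : List (WalkStep V)}
    (hP : IsTemporalWalk 𝒢 P) (f : V → ℤ)
    (hf : ∀ t x y, 𝒢.Active t x y → |f y - f x| ≤ 1) (a k : ℕ) (h : a + k < P.length) :
    P[a].time + k ≤ P[a + k].time ∧ |f P[a + k].src - f P[a].src| ≤ k := by
  induction k with
  | zero => simp
  | succ k ih =>
    obtain ⟨h1, h2⟩ := ih (by omega)
    obtain ⟨h3, h4⟩ := List.isChain_iff_getElem.1 hP.2 (a + k) (by omega)
    have h5 := hf _ _ _ (hP.1 P[a + k] (List.getElem_mem _))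
    rw [h3] at h5
    rw [abs_le] at *
    push_cast
    simp only [← add_assoc]
    omega

theorem IsTemporalWalk.length_le_walkTime {V : Type*} {𝒢 : TemporalGraph V} {P : List (WalkStep V)}
    (hP : IsTemporalWalk 𝒢 P) : P.length ≤ walkTime P := by
  rcases Nat.eq_zero_or_pos P.length with h | h
  · omega
  · have h1 := (hP.getElem_add (fun _ => 0) (by simp) 0 (P.length - 1) (by omega)).1
    obtain ⟨i, hi, -⟩ := hP.1 P[0] (List.getElem_mem _)
    rw [walkTime, List.getLast?_eq_getElem?, List.getElem?_eq_getElem (by omega)]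
    simp only [zero_add, Option.map_some, Option.getD_some] at h1 ⊢
    omega

theorem IsTemporalWalk.getElem_time_le_walkTime {V : Type*} {𝒢 : TemporalGraph V}
    {P : List (WalkStep V)} (hP : IsTemporalWalk 𝒢 P) (a : ℕ) (h : a < P.length) :
    P[a].time ≤ walkTime P := by
  have h1 := (hP.getElem_add (fun _ => 0) (by simp) a (P.length - 1 - a) (by omega)).1
  rw [walkTime, List.getLast?_eq_getElem?, List.getElem?_eq_getElem (by omega)]
  simp only [show a + (P.length - 1 - a) = P.length - 1 by omega] at h1
  simp only [Option.map_some, Option.getD_some]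
  omega

theorem IsExploration.card_le {V : Type*} [Fintype V] {𝒢 : TemporalGraph V} {u : V}
    {P : List (WalkStep V)} (hP : IsExploration 𝒢 u P) : Fintype.card V ≤ P.length + 1 := by
  classical
  obtain ⟨⟨-, hc⟩, hu, hx⟩ := hP
  have hsrc : ∀ (a : ℕ) (ha : a < P.length), P[a].src ∈ u :: P.map WalkStep.dst := by
    intro a ha
    cases a with
    | zero =>
      rw [List.head?_eq_getElem?, List.getElem?_eq_getElem ha] at hu
      simp only [Option.map_some, Option.some.injEq] at hu
      simp [hu]
    | succ a =>
      rw [← (List.isChain_iff_getElem.1 hc a ha).1]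
      exact List.mem_cons_of_mem _ (List.mem_map_of_mem (List.getElem_mem _))
  have hsub : (Finset.univ : Finset V) ⊆ (u :: P.map WalkStep.dst).toFinset := by
    intro x _
    rw [List.mem_toFinset]
    obtain ⟨s, hs, rfl | rfl⟩ := hx x
    · obtain ⟨a, ha, rfl⟩ := List.getElem_of_mem hs
      exact hsrc a ha
    · exact List.mem_cons_of_mem _ (List.mem_map_of_mem hs)
  calc Fintype.card V = (Finset.univ : Finset V).card := rfl
    _ ≤ _ := Finset.card_le_card hsub
    _ ≤ _ := List.toFinset_card_le _
    _ = P.length + 1 := by simp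

end Temporal

/-! ### Diameter of a layered graph -/

section Layered

variable {V : Type*} {G : SimpleGraph V} {g : V → ℕ} {d : ℕ}

theorem exists_walk_of_layer_add (hsurj : ∀ j ≤ d, ∃ x, g x = j) (hle : ∀ x, g x ≤ d)
    (hG : ∀ x y, G.Adj x y ↔ g x + 1 = g y ∨ g y + 1 = g x) (k : ℕ) :
    ∀ x y, g x + (k + 1) = g y → ∃ p : G.Walk x y, p.length = k + 1 := by
  induction k with
  | zero =>
    intro x y h
    exact ⟨.cons ((hG x y).2 (Or.inl h)) .nil, rfl⟩
  | succ k ih =>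
    intro x y h
    have := hle y
    obtain ⟨z, hz⟩ := hsurj (g x + 1) (by omega)
    obtain ⟨p, hp⟩ := ih z y (by omega)
    exact ⟨.cons ((hG x z).2 (Or.inl hz.symm)) p, by simp [hp]⟩

theorem layer_le_add_length (hG : ∀ x y, G.Adj x y ↔ g x + 1 = g y ∨ g y + 1 = g x) {x y : V}
    (p : G.Walk x y) : g y ≤ g x + p.length := by
  induction p with
  | nil => simp
  | cons h p ih =>
    rw [hG] at h
    rw [SimpleGraph.Walk.length_cons]
    omega

/-- Two vertices of one layer are joined by two edges through an adjacent layer, which needs `d ≥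
2`. An edge changes the layer by one, so the outermost layers are at distance at least `d`. -/
theorem ediam_layered (hd : 2 ≤ d) (hsurj : ∀ j ≤ d, ∃ x, g x = j) (hle : ∀ x, g x ≤ d)
    (hG : ∀ x y, G.Adj x y ↔ g x + 1 = g y ∨ g y + 1 = g x) : G.ediam = d := by
  refine le_antisymm (SimpleGraph.ediam_le_of_edist_le fun x y => ?_) ?_
  · have hx := hle x
    have hy := hle y
    have : ∃ p : G.Walk x y, p.length ≤ d := by
      rcases lt_trichotomy (g x) (g y) with h | h | h
      · obtain ⟨p, hp⟩ := exists_walk_of_layer_add hsurj hle hG (g y - g x - 1) x y (by omega)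
        exact ⟨p, by omega⟩
      · have : ∃ z, g x + 1 = g z ∨ g z + 1 = g x := by
          rcases Nat.eq_zero_or_pos (g x) with h0 | h0
          · obtain ⟨z, hz⟩ := hsurj (g x + 1) (by omega)
            exact ⟨z, by omega⟩
          · obtain ⟨z, hz⟩ := hsurj (g x - 1) (by omega)
            exact ⟨z, by omega⟩
        obtain ⟨z, hz⟩ := this
        exact ⟨.cons ((hG x z).2 hz) (.cons ((hG z y).2 (by omega)) .nil), by simpa using hd⟩
      · obtain ⟨p, hp⟩ := exists_walk_of_layer_add hsurj hle hG (g x - g y - 1) y x (by omega)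
        exact ⟨p.reverse, by rw [SimpleGraph.Walk.length_reverse]; omega⟩
    obtain ⟨p, hp⟩ := this
    exact (SimpleGraph.edist_le p).trans (by exact_mod_cast hp)
  · obtain ⟨x, hx⟩ := hsurj 0 (by omega)
    obtain ⟨y, hy⟩ := hsurj d le_rfl
    refine le_trans ?_ (SimpleGraph.edist_le_ediam (u := x) (v := y))
    by_contra! hlt
    obtain ⟨p, hp⟩ := SimpleGraph.exists_walk_of_edist_ne_top (ne_top_of_lt hlt)
    rw [← hp] at hlt
    have h1 : p.length < d := by exact_mod_cast hlt
    have h2 := layer_le_add_length hG p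
    omega

end Layered

/-! ### The active zone outruns every walk -/

section Bound

variable {n : ℕ} {f : Fin n → ℕ} {m K : ℕ}

/-- The ascending and descending halves of the rounds, numbered consecutively. -/
def ramp (m i : ℕ) : ℕ :=
  2 * (i / (m + 1)) + if i % (m + 1) ≤ m / 2 then 0 else 1

/-- Within one sweep the block index changes by exactly two per timestep, so the left side of `hb`
would be `8 (j - i)`, exceeding `20 + 2 (j - i)` once `j - i ≥ 4`. -/
theorem ramp_lt_ramp {i j : ℕ} (h : i + 4 ≤ j)
    (hb : |(4 * blockAt m (j % (m + 1)) - 4 * blockAt m (i % (m + 1)) : ℤ)| ≤ 20 + 2 * (j - i)) :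
    ramp m i < ramp m j := by
  have h1 := Nat.div_add_mod i (m + 1)
  have h2 := Nat.div_add_mod j (m + 1)
  have h3 : i / (m + 1) ≤ j / (m + 1) := Nat.div_le_div_right (by omega)
  unfold ramp
  rcases h3.lt_or_eq with h3 | h3
  · split_ifs <;> omega
  · rw [h3] at h1 ⊢
    generalize (m + 1) * (j / (m + 1)) = a at *
    generalize i % (m + 1) = r at *
    generalize j % (m + 1) = s at *
    rw [abs_le] at hb
    unfold blockAt at hb
    split_ifs at hb ⊢ <;> omega

theorem abs_letter_sub_le (hm : 1 ≤ m) {i : ℕ} {x : Fin n} (hx : x ∈ factor f m i) :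
    |(f x - (2 * blockAt m (i % (m + 1)) + 1) : ℤ)| ≤ 4 := by
  rw [factor, List.mem_append, mem_opening] at hx
  rw [abs_le]
  rcases hx with hx | hx
  · cases i with
    | zero => simp [carry] at hx
    | succ i =>
      have := blockAt_mod_succ hm i
      rw [carry, if_neg (by omega), mem_closing, Nat.add_sub_cancel] at hx
      omega
  · omega

theorem factor_of_getElem? {N i : ℕ} {A : List (Fin n)} (h : (factorList f m N)[i]? = some A) :
    A ⊆ factor f m i := by
  obtain ⟨hi, rfl⟩ := List.getElem?_eq_some_iff.1 h
  simp only [factorList, List.length_append, List.length_map, List.length_range,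
    List.length_singleton] at hi
  simp only [factorList]
  by_cases h1 : i < N
  · rw [List.getElem_append_left (by simpa using h1)]
    simp
  · obtain rfl : i = N := by omega
    rw [List.getElem_append_right (by simp)]
    simp [factor]

/-- One end point occurs in the factor and is within `4` of the central letter of its block; the
other end point is one letter further at most. -/
theorem active_bound (hm : 1 ≤ m) (hK : 1 ≤ K) (hf : ∀ x, f x ≤ 2 * m + 1)
    (hsurj : ∀ l, 1 ≤ l → l ≤ 2 * m + 1 → ∃ x, f x = l)
    {t : ℕ} {x y : Fin n} (h : (TG (wordPow (round f m) K)).Active t x y) :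
    1 ≤ t ∧ |(f y - f x : ℤ)| ≤ 1 ∧
      |(f x - (2 * blockAt m ((t - 1) % (m + 1)) + 1) : ℤ)| ≤ 5 := by
  rw [active_TG_iff, wordGraph_wordPow_round_adj hm hK hf,
    timestepFactors_wordPow_round hm hK hsurj] at h
  obtain ⟨h, i, A, rfl, hA, hxy⟩ := h
  have hsub := factor_of_getElem? hA
  refine ⟨by omega, by rw [abs_le]; omega, ?_⟩
  rw [Nat.add_sub_cancel]
  rcases hxy with hx | hy
  · have := abs_letter_sub_le hm (hsub hx)
    rw [abs_le] at *
    omega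
  · have := abs_letter_sub_le hm (hsub hy)
    rw [abs_le] at *
    omega

theorem exists_active (hm : 1 ≤ m) (hK : 1 ≤ K) (hf : ∀ x, f x ≤ 2 * m + 1)
    (hsurj : ∀ l, 1 ≤ l → l ≤ 2 * m + 1 → ∃ x, f x = l)
    {r : ℕ} (hr : r < K) {x y : Fin n} (hxy : f x + 1 = f y ∨ f y + 1 = f x) :
    ∃ t, r * (m + 1) < t ∧ t ≤ (r + 1) * (m + 1) ∧
      (TG (wordPow (round f m) K)).Active t x y := by
  have hx := hf x
  have hy := hf y
  obtain ⟨k, hk⟩ : ∃ k, f x = 2 * k + 1 ∨ f y = 2 * k + 1 := by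
    rcases Nat.even_or_odd' (f x) with ⟨a, ha | ha⟩
    · rcases Nat.even_or_odd' (f y) with ⟨b, hb | hb⟩
      · omega
      · exact ⟨b, Or.inr hb⟩
    · exact ⟨a, Or.inl ha⟩
  have hkm : k ≤ m := by omega
  have hpos := blockPos_le hkm
  have hlt : r * (m + 1) + blockPos m k < K * (m + 1) := by
    have : (r + 1) * (m + 1) ≤ K * (m + 1) := Nat.mul_le_mul_right _ hr
    rw [add_mul] at this
    omega
  refine ⟨r * (m + 1) + blockPos m k + 1, by omega, by rw [add_mul]; omega, ?_⟩
  rw [active_TG_iff, wordGraph_wordPow_round_adj hm hK hf,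
    timestepFactors_wordPow_round hm hK hsurj]
  refine ⟨hxy, r * (m + 1) + blockPos m k, factor f m (r * (m + 1) + blockPos m k), rfl, ?_, ?_⟩
  · rw [factorList, List.getElem?_append_left (by simpa using hlt)]
    simp [hlt]
  · have hmod : (r * (m + 1) + blockPos m k) % (m + 1) = blockPos m k := by
      rw [Nat.mul_add_mod_self_right, Nat.mod_eq_of_lt (by omega)]
    simp only [factor, List.mem_append, mem_opening, hmod, blockAt_blockPos hkm]
    omega

theorem le_ramp (hm : 1 ≤ m) (hK : 1 ≤ K) (hf : ∀ x, f x ≤ 2 * m + 1)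
    (hsurj : ∀ l, 1 ≤ l → l ≤ 2 * m + 1 → ∃ x, f x = l)
    {P : List (WalkStep (Fin n))}
    (hP : IsTemporalWalk (TG (wordPow (round f m) K)) P) (a : ℕ) :
    ∀ h : 4 * a < P.length, a ≤ ramp m (P[4 * a].time - 1) := by
  induction a with
  | zero => simp
  | succ a ih =>
    intro h
    have hact : ∀ i (hi : i < P.length), _ := fun i hi =>
      active_bound hm hK hf hsurj (hP.1 P[i] (List.getElem_mem hi))
    have h0 := ih (by omega)
    obtain ⟨h1, h2⟩ := hP.getElem_add (fun x => (f x : ℤ))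
      (fun t x y h => (active_bound hm hK hf hsurj h).2.1) (4 * a) 4 (by omega)
    obtain ⟨h3, -, h4⟩ := hact (4 * a) (by omega)
    obtain ⟨h5, -, h6⟩ := hact (4 * a + 4) (by omega)
    refine Nat.lt_of_le_of_lt h0 (ramp_lt_ramp ?_ ?_)
    · change _ ≤ P[4 * a + 4].time - 1
      omega
    · change |(4 * blockAt m ((P[4 * a + 4].time - 1) % (m + 1)) - _ : ℤ)| ≤
        20 + 2 * (((P[4 * a + 4].time - 1 : ℕ) : ℤ) - _)
      rw [abs_le] at *
      omega

/-- Every sweep holds at most four edges up to rounding, and a round has two sweeps, whence the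
factor `8`. -/
theorem card_le_of_isExploration (hm : 1 ≤ m) (hK : 1 ≤ K) (hf : ∀ x, f x ≤ 2 * m + 1)
    (hsurj : ∀ l, 1 ≤ l → l ≤ 2 * m + 1 → ∃ x, f x = l)
    {u : Fin n} {P : List (WalkStep (Fin n))}
    (hP : IsExploration (TG (wordPow (round f m) K)) u P) :
    n ≤ 8 * ((walkTime P - 1) / (m + 1)) + 9 := by
  have hcard := hP.card_le
  rw [Fintype.card_fin] at hcard
  rcases Nat.eq_zero_or_pos P.length with h | h
  · omega
  have h1 := le_ramp hm hK hf hsurj hP.1 ((P.length - 1) / 4) (by omega)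
  have h2 := hP.1.getElem_time_le_walkTime (4 * ((P.length - 1) / 4)) (by omega)
  have h3 : (P[4 * ((P.length - 1) / 4)].time - 1) / (m + 1) ≤ (walkTime P - 1) / (m + 1) :=
    Nat.div_le_div_right (by omega)
  unfold ramp at h1
  split_ifs at h1 <;> omega

end Bound

/-! ### The complete graph, for diameter one -/

section Complete

variable {n : ℕ}

theorem timestepFactors_wordPow_finRange (hn : n ≠ 0) (K : ℕ) :
    timestepFactors (wordPow (List.finRange n) K) = List.replicate K (List.finRange n) := by
  obtain ⟨n, rfl⟩ := Nat.exists_eq_succ_of_ne_zero hn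
  refine timestepFactors_flatten ?_ ?_ ?_
  · intro A hA
    rw [List.eq_of_mem_replicate hA]
    simp
  · intro A hA
    rw [List.eq_of_mem_replicate hA]
    exact List.nodup_finRange _
  · rw [List.isChain_iff_getElem]
    intro i hi
    simp only [List.getElem_replicate]
    exact ⟨0, List.mem_finRange _, by simp [List.finRange_succ]⟩

theorem wordGraph_wordPow_finRange (n K : ℕ) : wordGraph (wordPow (List.finRange n) K) = ⊤ := by
  have key : ∀ (x y : Fin n) (k : ℕ), x < y → Alternate (wordPow (List.finRange n) k) x y := by
    intro x y k hxy
    have h : proj {x, y} (List.finRange n) = [x, y] := by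
      refine List.Perm.eq_of_pairwise (le := (· < ·)) ?_
        ((List.pairwise_lt_finRange n).filter _) (by simpa using hxy) ?_
      · intro a b _ _ h1 h2
        exact absurd h1 h2.asymm
      · refine (List.perm_ext_iff_of_nodup ((List.nodup_finRange n).filter _)
          (by simpa using hxy.ne)).2 fun a => ?_
        simp
    exact ⟨k, Or.inl (by rw [proj_wordPow, h])⟩
  ext x y
  simp only [SimpleGraph.top_adj]
  refine ⟨fun h => h.1, fun h => ⟨h, ?_⟩⟩
  rcases lt_or_gt_of_ne h with h | h
  · exact key x y K h
  · exact (key y x K h).symm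

theorem active_TG_wordPow_finRange {K r : ℕ} (hr : r < K) {x y : Fin n} (hxy : x ≠ y) :
    (TG (wordPow (List.finRange n) K)).Active (r + 1) x y := by
  have hn : n ≠ 0 := by rintro rfl; exact x.elim0
  rw [active_TG_iff, wordGraph_wordPow_finRange, timestepFactors_wordPow_finRange hn]
  exact ⟨hxy, r, List.finRange n, rfl, by simp [hr], by simp⟩

end Complete

/-! ### The words for `d = 1` and for `d ≥ 2` -/

theorem exists_word_complete {n : ℕ} (hn : 2 ≤ n) : ∃ v : List (Fin n), (∀ x, x ∈ v) ∧
    (TG v).underlying.ediam = 1 ∧ (∀ u, ∃ P, IsExploration (TG v) u P) := by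
  have : Nontrivial (Fin n) := Fin.nontrivial_iff_two_le.2 hn
  obtain ⟨L, hL⟩ := exists_covering_walk (G := (⊤ : SimpleGraph (Fin n)))
    SimpleGraph.preconnected_top
  refine ⟨wordPow (List.finRange n) (L + 1), ?_, ?_, ?_⟩
  · intro x
    rw [wordPow_succ]
    simp
  · have : (TG (wordPow (List.finRange n) (L + 1))).underlying = ⊤ := by
      ext x y
      rw [underlying_adj_iff, SimpleGraph.top_adj]
      exact ⟨fun ⟨t, h⟩ => (active_TG_iff.1 h).1.1,
        fun h => ⟨_, active_TG_wordPow_finRange (Nat.succ_pos L) h⟩⟩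
    rw [this, SimpleGraph.ediam_top]
  · intro u
    obtain ⟨v, p, hp, hs⟩ := hL u
    exact exists_isExploration (M := 1) (K := L + 1)
      (fun r hr x y h => ⟨r + 1, by omega, by omega, active_TG_wordPow_finRange hr h⟩) p
      (by omega) hs

theorem exists_word_layered {n d : ℕ} (hd : 2 ≤ d) (hdn : d < n) : ∃ v : List (Fin n),
    (∀ x, x ∈ v) ∧ (TG v).underlying.ediam = d ∧ (∀ u, ∃ P, IsExploration (TG v) u P) ∧
    (∀ u P, IsExploration (TG v) u P → n ≤ 8 * ((walkTime P - 1) / (d / 2 + 1)) + 9) ∧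
    ∀ x y : Fin n, (TG v).underlying.Adj x y ↔
      (x : ℕ) % (d + 1) + 1 = (y : ℕ) % (d + 1) ∨ (y : ℕ) % (d + 1) + 1 = (x : ℕ) % (d + 1) := by
  have : Nontrivial (Fin n) := Fin.nontrivial_iff_two_le.2 (by omega)
  obtain ⟨m, hm⟩ : ∃ m, m = d / 2 := ⟨_, rfl⟩
  rw [← hm]
  set g : Fin n → ℕ := fun x => (x : ℕ) % (d + 1) with hg
  -- The shift is `0` for odd `d` and `1` for even `d`, where letter `0` stays unused; the top
  -- letter is then always the odd `2m+1`.
  set f : Fin n → ℕ := fun x => g x + (2 * m + 1 - d) with hfd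
  have hgle : ∀ x, g x ≤ d := fun x => Nat.lt_succ_iff.1 (Nat.mod_lt _ (Nat.succ_pos d))
  have hgsurj : ∀ j ≤ d, ∃ x, g x = j := fun j hj =>
    ⟨⟨j, by omega⟩, Nat.mod_eq_of_lt (Nat.lt_succ_of_le hj)⟩
  have hm1 : 1 ≤ m := by omega
  have hf : ∀ x, f x ≤ 2 * m + 1 := fun x => by have := hgle x; simp only [hfd]; omega
  have hsurj : ∀ l, 1 ≤ l → l ≤ 2 * m + 1 → ∃ x, f x = l := by
    intro l h1 h2
    obtain ⟨x, hx⟩ := hgsurj (l - (2 * m + 1 - d)) (by omega)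
    exact ⟨x, by simp only [hfd, hx]; omega⟩
  have hfg : ∀ x y, (f x + 1 = f y ∨ f y + 1 = f x) ↔ (g x + 1 = g y ∨ g y + 1 = g x) := by
    intro x y
    simp only [hfd]
    omega
  have hunder : ∀ K, 1 ≤ K → ∀ x y,
      (TG (wordPow (round f m) K)).underlying.Adj x y ↔ g x + 1 = g y ∨ g y + 1 = g x := by
    intro K hK x y
    rw [underlying_adj_iff, ← hfg]
    constructor
    · rintro ⟨t, h⟩
      exact (wordGraph_wordPow_round_adj hm1 hK hf x y).1 (active_TG_iff.1 h).1
    · intro h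
      obtain ⟨t, -, -, h⟩ := exists_active hm1 hK hf hsurj (r := 0) (by omega) h
      exact ⟨t, h⟩
  have hdiam := fun K hK => ediam_layered hd hgsurj hgle (hunder K hK)
  -- The underlying graph is the same for every number of rounds, so one round suffices to find `L`,
  -- which then fixes the number of rounds.
  have hpre : (TG (wordPow (round f m) 1)).underlying.Preconnected :=
    SimpleGraph.preconnected_of_ediam_ne_top (by rw [hdiam 1 le_rfl]; exact ENat.natCast_ne_top d)
  obtain ⟨L, hL⟩ := exists_covering_walk hpre
  have hK : 1 ≤ L + 1 := by omega
  refine ⟨wordPow (round f m) (L + 1), ?_, hdiam _ hK, ?_, ?_, hunder _ hK⟩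
  · intro x
    have hx := hf x
    rw [wordPow_succ, List.mem_append]
    refine Or.inl ((block_infix_round f (k := f x / 2) (by omega)).subset ?_)
    rw [mem_block]
    omega
  · intro u
    obtain ⟨v, p, hp, hs⟩ := hL u
    exact exists_isExploration (M := m + 1) (K := L + 1)
      (fun r hr x y h => exists_active hm1 hK hf hsurj hr
        ((hfg x y).2 ((hunder 1 le_rfl x y).1 h))) p (by omega) hs
  · intro u P hP
    exact card_le_of_isExploration hm1 hK hf hsurj hP

end WordTemporal

/-! ### The constant and the layer sizes -/

theorem mainTheorem4 :
    ∃ c : ℝ, 0 < c ∧ ∀ n d : ℕ, 1 ≤ d → d < n →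
      ∃ v : List (Fin n),
        (∀ x : Fin n, x ∈ v) ∧
        (WordTemporal.TG v).underlying.ediam = (d : ℕ∞) ∧
        (∀ u : Fin n, ∃ P : List (WordTemporal.WalkStep (Fin n)),
          WordTemporal.IsExploration (WordTemporal.TG v) u P) ∧
        (∀ (u : Fin n) (P : List (WordTemporal.WalkStep (Fin n))),
          WordTemporal.IsExploration (WordTemporal.TG v) u P →
            c * (d : ℝ) * (n : ℝ) ≤ (WordTemporal.walkTime P : ℝ)) ∧
        (2 ≤ d → ∃ layer : Fin n → Fin (d + 1),
          (∀ x y : Fin n, (WordTemporal.TG v).underlying.Adj x y ↔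
            ((layer x : ℕ) + 1 = (layer y : ℕ) ∨ (layer y : ℕ) + 1 = (layer x : ℕ))) ∧
          (∀ j : Fin (d + 1),
            n / (d + 1) ≤ (Finset.univ.filter (fun x : Fin n => layer x = j)).card ∧
            (Finset.univ.filter (fun x : Fin n => layer x = j)).card ≤ n / (d + 1) + 1)) := by
  have trivial_bound : ∀ {n : ℕ} {v : List (Fin n)} {u : Fin n}
      {P : List (WordTemporal.WalkStep (Fin n))},
      WordTemporal.IsExploration (WordTemporal.TG v) u P → n ≤ WordTemporal.walkTime P + 1 := by
    intro n v u P hP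
    have h1 := hP.card_le
    have h2 := hP.1.length_le_walkTime
    rw [Fintype.card_fin] at h1
    omega
  have cast_bound : ∀ {n d T : ℕ}, d * n ≤ 34 * T → (1 / 34 : ℝ) * d * n ≤ T := by
    intro n d T h
    have h : (d * n : ℝ) ≤ 34 * T := by exact_mod_cast h
    linarith
  -- With `q` complete rounds before the last timestep, `n ≤ 8q + 9 ≤ 17q` if `q ≥ 1`, and `d ≤ 2 (d
  -- / 2 + 1)`; the product gives `34`. If `q = 0`, then `d < n ≤ 9` and the trivial bound is
  -- enough.
  refine ⟨1 / 34, by norm_num, fun n d hd hdn => ?_⟩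
  rcases Nat.lt_or_ge d 2 with hd2 | hd2
  · obtain rfl : d = 1 := by omega
    obtain ⟨v, h1, h2, h3⟩ := WordTemporal.exists_word_complete (n := n) (by omega)
    refine ⟨v, h1, by simpa using h2, h3, fun u P hP => cast_bound ?_, fun h => by omega⟩
    have := trivial_bound hP
    omega
  · obtain ⟨v, h1, h2, h3, h4, h5⟩ := WordTemporal.exists_word_layered hd2 hdn
    refine ⟨v, h1, h2, h3, fun u P hP => cast_bound ?_, fun _ =>
      ⟨fun x => ⟨(x : ℕ) % (d + 1), Nat.mod_lt _ (Nat.succ_pos d)⟩, h5, fun j => ?_⟩⟩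
    · have hT := trivial_bound hP
      have hq := h4 u P hP
      have hmul := Nat.div_mul_le_self (WordTemporal.walkTime P - 1) (d / 2 + 1)
      generalize (WordTemporal.walkTime P - 1) / (d / 2 + 1) = q at *
      rcases Nat.eq_zero_or_pos q with rfl | hq0
      · have : d ≤ 8 := by omega
        calc d * n ≤ 8 * n := Nat.mul_le_mul_right _ this
          _ ≤ _ := by omega
      · have h6 : n ≤ 17 * q := by omega
        have h7 : d ≤ 2 * (d / 2 + 1) := by omega
        calc d * n ≤ (2 * (d / 2 + 1)) * (17 * q) := Nat.mul_le_mul h7 h6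
          _ = 34 * (q * (d / 2 + 1)) := by ring
          _ ≤ _ := by omega
    -- Layers are residue classes modulo `d + 1`, whose sizes in `0, …, n-1` differ by at most one.
    · have hcard : (Finset.univ.filter (fun x : Fin n =>
          (⟨(x : ℕ) % (d + 1), Nat.mod_lt _ (Nat.succ_pos d)⟩ : Fin (d + 1)) = j)).card =
          n.count (· ≡ j [MOD (d + 1)]) := by
        rw [Nat.count_eq_card_filter_range]
        have hj : (j : ℕ) % (d + 1) = j := Nat.mod_eq_of_lt j.2
        refine Finset.card_nbij Fin.val ?_ Fin.val_injective.injOn ?_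
        · intro x hx
          simpa [Fin.ext_iff, Nat.ModEq, hj] using hx
        · intro y hy
          have hy : y < n ∧ y % (d + 1) = j := by simpa [Nat.ModEq, hj] using hy
          exact ⟨⟨y, hy.1⟩, by simpa [Fin.ext_iff] using hy.2, rfl⟩
      rw [hcard, Nat.count_modEq_card _ (Nat.succ_pos d), Nat.succ_eq_add_one]
      split_ifs <;> omega
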